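/- Let $2<p<\infty$ and let $w=(w_n)_{n\ge 1}$ be a sequence of positive real numbers with $w_n\to 0$ and $\sum_{n=1}^\infty w_n^{2p/(p-2)}=\infty$. Let $X_{p,w}$ be the Rosenthal space, i.e. the Banach space of all real sequences $x=(x_n)$ such that $(x_n)\in\ell_p$ and $(x_nw_n)\in\ell_2$, with the norm $\|x\|_{X_{p,w}}=\max\{\|(x_n)\|_p,\ \|(x_nw_n)\|_2\}$, and let $(e_n)$ be its unit vector basis with coordinate functionals $e_n^*(x)=x_n$. Then $(e_n)$ has the factorization property: for every bounded linear operator $T\colon X_{p,w}\to X_{p,w}$ with large diagonal, that is, with $\inf_n |e_n^*(Te_n)|>0$, there are bounded linear operators $A,B\colon X_{p,w}\to X_{p,w}$ such that $ATB$ is the identity operator on $X_{p,w}$. -/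

import Mathlib

open Filter Topology

noncomputable section

/-- The linear space of all real sequences `x` with `x ∈ ℓ_p` and `(x_n w_n) ∈ ℓ_2`. -/
def rosenthalSubmodule (p : ℝ) (w : ℕ → ℝ) : Submodule ℝ (ℕ → ℝ) where
  carrier := {x | Memℓp x (ENNReal.ofReal p) ∧ Memℓp (fun n => x n * w n) 2}
  zero_mem' := ⟨zero_memℓp, by simpa using zero_mem_ℓp' (E := fun _ : ℕ => ℝ)⟩
  add_mem' := fun {x y} hx hy => ⟨hx.1.add hy.1, by
    have h : (fun n => (x + y) n * w n) = (fun n => x n * w n) + (fun n => y n * w n) := by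
      funext n
      simp [add_mul]
    show Memℓp (fun n => (x + y) n * w n) 2
    rw [h]
    exact hx.2.add hy.2⟩
  smul_mem' := fun c x hx => ⟨hx.1.const_smul c, by
    have h : (fun n => (c • x) n * w n) = c • (fun n => x n * w n) := by
      funext n
      simp [mul_assoc]
    show Memℓp (fun n => (c • x) n * w n) 2
    rw [h]
    exact hx.2.const_smul c⟩

/-- The Rosenthal space `X_{p,w}`, as a type of its own so that it does not inherit the
topology of pointwise convergence. -/
def RosenthalX (p : ℝ) (w : ℕ → ℝ) : Type := rosenthalSubmodule p w

namespace RosenthalX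

variable {p : ℝ} {w : ℕ → ℝ}

instance : AddCommGroup (RosenthalX p w) := inferInstanceAs (AddCommGroup (rosenthalSubmodule p w))

instance : Module ℝ (RosenthalX p w) := inferInstanceAs (Module ℝ (rosenthalSubmodule p w))

/-- The sequence underlying an element of `X_{p,w}`. -/
instance : CoeFun (RosenthalX p w) (fun _ => ℕ → ℝ) := ⟨fun x => x.1⟩

@[ext] theorem ext {x y : RosenthalX p w} (h : ∀ n, x n = y n) : x = y := Subtype.ext (funext h)

@[simp] theorem add_apply (x y : RosenthalX p w) (n : ℕ) : (x + y) n = x n + y n := rfl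

@[simp] theorem smul_apply (c : ℝ) (x : RosenthalX p w) (n : ℕ) : (c • x) n = c * x n := rfl

/-- The sequence `(x_n)` as an element of `ℓ_p`. -/
def fstLp (x : RosenthalX p w) : lp (fun _ : ℕ => ℝ) (ENNReal.ofReal p) := ⟨x.1, x.2.1⟩

/-- The sequence `(x_n w_n)` as an element of `ℓ_2`. -/
def sndLp (x : RosenthalX p w) : lp (fun _ : ℕ => ℝ) 2 := ⟨fun n => x n * w n, x.2.2⟩

@[simp] theorem fstLp_apply (x : RosenthalX p w) (n : ℕ) : fstLp x n = x n := rfl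

@[simp] theorem sndLp_apply (x : RosenthalX p w) (n : ℕ) : sndLp x n = x n * w n := rfl

/-- The linear map `x ↦ ((x_n), (x_n w_n))` into `ℓ_p × ℓ_2`. -/
def toProd (p : ℝ) (w : ℕ → ℝ) : RosenthalX p w →ₗ[ℝ]
    lp (fun _ : ℕ => ℝ) (ENNReal.ofReal p) × lp (fun _ : ℕ => ℝ) 2 where
  toFun x := (fstLp x, sndLp x)
  map_add' x y := by
    refine Prod.ext (lp.ext (funext fun n => ?_)) (lp.ext (funext fun n => ?_))
    · rfl
    · exact add_mul (x n) (y n) (w n)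
  map_smul' c x := by
    refine Prod.ext (lp.ext (funext fun n => ?_)) (lp.ext (funext fun n => ?_))
    · rfl
    · exact mul_assoc c (x n) (w n)

theorem toProd_injective : Function.Injective (toProd p w) := fun _ _ h =>
  RosenthalX.ext fun n => congrFun (congrArg Subtype.val (congrArg Prod.fst h)) n

instance factOneLe [hp : Fact (2 < p)] : Fact (1 ≤ ENNReal.ofReal p) :=
  ⟨by rw [ENNReal.one_le_ofReal]; linarith [hp.out]⟩

section Norm

variable [Fact (2 < p)]

/-- The norm `max (‖(x_n)‖_p) (‖(x_n w_n)‖_2)`, see `norm_def`. -/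
instance : NormedAddCommGroup (RosenthalX p w) :=
  NormedAddCommGroup.induced _ _ (toProd p w) toProd_injective

theorem norm_def (x : RosenthalX p w) : ‖x‖ = max ‖fstLp x‖ ‖sndLp x‖ := rfl

instance : NormedSpace ℝ (RosenthalX p w) := NormedSpace.induced ℝ _ _ (toProd p w)

theorem isometry_toProd : Isometry (toProd p w) :=
  AddMonoidHomClass.isometry_of_norm (toProd p w) fun _ => rfl

instance : CompleteSpace (RosenthalX p w) := by
  have hpos : ENNReal.ofReal p ≠ 0 := by
    have := (factOneLe (p := p)).out
    intro h
    simp [h] at this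
  have hrange : Set.range (toProd p w) = ⋂ n : ℕ, {z | z.2 n = z.1 n * w n} := by
    ext z
    simp only [Set.mem_range, Set.mem_iInter, Set.mem_ofPred_eq]
    constructor
    · rintro ⟨x, rfl⟩ n
      rfl
    · intro h
      have hz : (fun n => z.1 n * w n) = z.2 := funext fun n => (h n).symm
      refine ⟨⟨z.1, lp.memℓp z.1, ?_⟩, ?_⟩
      · show Memℓp (fun n => z.1 n * w n) 2
        rw [hz]
        exact lp.memℓp z.2
      · refine Prod.ext (lp.ext rfl) (lp.ext hz)
  have hclosed : IsClosed (Set.range (toProd p w)) := by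
    rw [hrange]
    refine isClosed_iInter fun n => isClosed_eq ?_ ?_
    · exact (lp.lipschitzWith_one_eval 2 n).continuous.comp continuous_snd
    · exact ((lp.lipschitzWith_one_eval (ENNReal.ofReal p) n).continuous.comp
        continuous_fst).mul continuous_const
  exact (completeSpace_iff_isComplete_range isometry_toProd.isUniformInducing).mpr
    hclosed.isComplete

end Norm

section Basis

/-- The unit vector `e_i`. -/
def unitVector (p : ℝ) (w : ℕ → ℝ) (i : ℕ) : RosenthalX p w :=
  ⟨Pi.single i 1, by
    constructor
    · exact lp.memℓp (lp.single (E := fun _ : ℕ => ℝ) (ENNReal.ofReal p) i 1)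
    · have h : (fun n => (Pi.single i 1 : ℕ → ℝ) n * w n) = Pi.single i (w i) := by
        funext n
        by_cases hn : n = i
        · subst hn
          simp
        · simp [hn]
      rw [h]
      exact lp.memℓp (lp.single (E := fun _ : ℕ => ℝ) 2 i (w i))⟩

/-- The coordinate functional `x ↦ x_i`. -/
def coordFunctional (p : ℝ) [Fact (2 < p)] (w : ℕ → ℝ) (i : ℕ) : StrongDual ℝ (RosenthalX p w) :=
  LinearMap.mkContinuous
    { toFun := fun x => x i
      map_add' := fun _ _ => rfl
      map_smul' := fun _ _ => rfl } 1 (fun x => by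
        rw [one_mul]
        have hpos : ENNReal.ofReal p ≠ 0 := by
          have := (factOneLe (p := p)).out
          intro h
          simp [h] at this
        exact (lp.norm_apply_le_norm hpos (fstLp x) i).trans (le_max_left _ _))

/-- The unit vectors `(e_n)`, with the coordinate functionals `e_n^*(x) = x_n`, as a Schauder
basis of `X_{p,w}`. -/
def unitVectorBasis (p : ℝ) [Fact (2 < p)] (w : ℕ → ℝ) : SchauderBasis ℝ (RosenthalX p w) where
  basis := unitVector p w
  coord := coordFunctional p w
  ortho i j := by
    show (Pi.single j 1 : ℕ → ℝ) i = _
    simp [Pi.single_apply]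
  expansion x := by
    have h1 : HasSum (fun i => lp.single (E := fun _ : ℕ => ℝ) (ENNReal.ofReal p) i (fstLp x i))
        (fstLp x) := lp.hasSum_single ENNReal.ofReal_ne_top (fstLp x)
    have h2 : HasSum (fun i => lp.single (E := fun _ : ℕ => ℝ) 2 i (sndLp x i))
        (sndLp x) := lp.hasSum_single ENNReal.ofNat_ne_top (sndLp x)
    have h3 := h1.prodMk h2
    have h4 : HasSum (fun i => coordFunctional p w i x • unitVector p w i) x := by
      refine isometry_toProd.isUniformInducing.isInducing.tendsto_nhds_iff.mpr ?_
      have h5 : HasSum (fun i => toProd p w (coordFunctional p w i x • unitVector p w i))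
          (toProd p w x) := ?_
      · refine Tendsto.congr (fun s => ?_) h5
        exact (map_sum (toProd p w) _ s).symm
      refine (congrArg (fun f => HasSum f (toProd p w x)) (funext fun i => ?_)).mpr h3
      refine Prod.ext (lp.ext (funext fun n => ?_)) (lp.ext (funext fun n => ?_))
      · show x i * (Pi.single i 1 : ℕ → ℝ) n = (Pi.single i (x i) : ℕ → ℝ) n
        by_cases hn : n = i
        · subst hn
          simp
        · simp [hn]
      · show x i * (Pi.single i 1 : ℕ → ℝ) n * w n = (Pi.single i (x i * w i) : ℕ → ℝ) n
        by_cases hn : n = i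
        · subst hn
          simp
        · simp [hn]
    exact h4.mono_left (SummationFilter.conditional ℕ).le_atTop

end Basis

end RosenthalX

section Factorization

variable {X : Type*} [NormedAddCommGroup X] [NormedSpace ℝ X]

/-- `T` is a factor of the identity: `I = A T B` for some bounded linear operators `A`, `B`. -/
def IsFactorOfIdentity (T : X →L[ℝ] X) : Prop :=
  ∃ A B : X →L[ℝ] X, ContinuousLinearMap.id ℝ X = A ∘L T ∘L B

/-- `T` has large diagonal with respect to `(e_n)`: `inf_n |e_n^*(T e_n)| > 0`. -/
def HasLargeDiagonal (e : SchauderBasis ℝ X) (T : X →L[ℝ] X) : Prop :=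
  0 < ⨅ n, |e.coord n (T (e n))|

/-- The basis `(e_n)` has the factorization property: every bounded linear operator with large
diagonal is a factor of the identity. -/
def HasFactorizationProperty (e : SchauderBasis ℝ X) : Prop :=
  ∀ T : X →L[ℝ] X, HasLargeDiagonal e T → IsFactorOfIdentity T

end Factorization

/-- A sequence of positive reals with `w_n → 0` and `∑ w_n^{2p/(p-2)} = ∞`. -/
structure IsRosenthalWeight (p : ℝ) (w : ℕ → ℝ) : Prop where
  pos : ∀ n, 0 < w n
  tendsto_zero : Tendsto w atTop (𝓝 0)
  sum_eq_top : Tendsto (fun N => ∑ n ∈ Finset.range N, w n ^ (2 * p / (p - 2))) atTop atTop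

end

/-!
# The factorization property of the unit vector basis of Rosenthal's space

A multiplier by signs reduces the claim to an operator `T` with diagonal at least `δ > 0`.

Rosenthal's blocks: since `w_n → 0` and the sum of `w_n ^ q`, `q = 2p / (p - 2)`, diverges, there
are, arbitrarily far out, finite sets `E` on which `w_j ^ q` sums to a number comparable to a given
`t ^ q`. Such a set carries a vector `f` and a functional `g` with `g f = 1`, where `f` behaves like
a unit vector of weight between `t` and `2t`, and `g` is bounded accordingly (`exists_isBlock`). For
disjoint blocks with `t = w_n`, the map `J : e_n ↦ f_n` and the map `Q : y ↦ (g_n y)_n` are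
therefore bounded operators of `X_{p,w}` (`exists_synthesis`, `exists_analysis`).

The coefficients of `f` and `g` may be multiplied by the same signs. The average of `g (T f)` over
all choices of signs involves only diagonal entries of `T`, and is at least `δ`, so that some choice
gives `g (T f) ≥ δ` (`exists_isBlock_le_apply`).

The entries `g_m (T f_n)` with `m ≠ n` become as small as desired if each block lies far beyond the
earlier ones: the coordinates of `T f_m` are small far out, and so are the functionals `g_m ∘ T`,
because the basis is shrinking (`exists_forall_support_le`). Hence `Q T J` is a small perturbation
of a diagonal operator with entries at least `δ`, and has a left inverse
(`exists_leftInverse_of_offDiag_le`). This gives the factorization.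
-/

noncomputable section

namespace RosenthalX

variable {p : ℝ} {w : ℕ → ℝ}

/-! ### Norms of elements and construction of operators -/

section NormEstimates

variable [hp : Fact (2 < p)]

theorem toReal_ofReal_exponent : (ENNReal.ofReal p).toReal = p :=
  ENNReal.toReal_ofReal (by linarith [hp.out])

theorem toReal_exponent_pos : 0 < (ENNReal.ofReal p).toReal := by
  rw [toReal_ofReal_exponent]; linarith [hp.out]

theorem sum_abs_rpow_le (x : RosenthalX p w) (s : Finset ℕ) :
    ∑ i ∈ s, |x i| ^ p ≤ ‖x‖ ^ p := by
  have h := lp.sum_rpow_le_norm_rpow toReal_exponent_pos (fstLp x) s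
  rw [toReal_ofReal_exponent] at h
  exact h.trans (Real.rpow_le_rpow (norm_nonneg _) (le_max_left _ _) (by linarith [hp.out]))

theorem sum_sq_le (x : RosenthalX p w) (s : Finset ℕ) :
    ∑ i ∈ s, (x i * w i) ^ 2 ≤ ‖x‖ ^ 2 := by
  have h := lp.sum_rpow_le_norm_rpow (by norm_num) (sndLp x) s
  simp only [ENNReal.toReal_ofNat, Real.rpow_two, Real.norm_eq_abs, sq_abs] at h
  exact h.trans (pow_le_pow_left₀ (norm_nonneg _) (le_max_right _ _) 2)

theorem norm_le_of_forall_sum_le {C : ℝ} (hC : 0 ≤ C) (x : RosenthalX p w)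
    (h1 : ∀ s : Finset ℕ, ∑ i ∈ s, |x i| ^ p ≤ C ^ p)
    (h2 : ∀ s : Finset ℕ, ∑ i ∈ s, (x i * w i) ^ 2 ≤ C ^ 2) : ‖x‖ ≤ C := by
  refine max_le ?_ ?_
  · refine lp.norm_le_of_forall_sum_le toReal_exponent_pos hC fun s => ?_
    rw [toReal_ofReal_exponent]
    exact h1 s
  · refine lp.norm_le_of_forall_sum_le (by norm_num) hC fun s => ?_
    simp only [ENNReal.toReal_ofNat, Real.rpow_two, Real.norm_eq_abs, sq_abs]
    exact h2 s

theorem abs_apply_le (x : RosenthalX p w) (i : ℕ) : |x i| ≤ ‖x‖ := by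
  have h := sum_abs_rpow_le x {i}
  rw [Finset.sum_singleton] at h
  exact (Real.rpow_le_rpow_iff (abs_nonneg _) (norm_nonneg _) (by linarith [hp.out])).1 h

/-- A linear map into sequences that satisfies the two norm estimates on finite sets of
coordinates is a bounded operator of `X_{p,w}`. -/
theorem exists_clm_of_forall_sum_le {C : ℝ} (hC : 0 ≤ C) (L : RosenthalX p w →ₗ[ℝ] (ℕ → ℝ))
    (h1 : ∀ x (s : Finset ℕ), ∑ i ∈ s, |L x i| ^ p ≤ (C * ‖x‖) ^ p)
    (h2 : ∀ x (s : Finset ℕ), ∑ i ∈ s, (L x i * w i) ^ 2 ≤ (C * ‖x‖) ^ 2) :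
    ∃ S : RosenthalX p w →L[ℝ] RosenthalX p w, ∀ x i, S x i = L x i := by
  have hmem : ∀ x, L x ∈ rosenthalSubmodule p w := fun x =>
    ⟨memℓp_gen' (C := (C * ‖x‖) ^ p) fun s => by
      rw [toReal_ofReal_exponent]; exact h1 x s,
     memℓp_gen' (C := (C * ‖x‖) ^ 2) fun s => by
      simp only [ENNReal.toReal_ofNat, Real.rpow_two, Real.norm_eq_abs, sq_abs]
      exact h2 x s⟩
  let S : RosenthalX p w →ₗ[ℝ] RosenthalX p w :=
    { toFun := fun x => (⟨L x, hmem x⟩ : rosenthalSubmodule p w)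
      map_add' := fun x y => Subtype.ext (L.map_add x y)
      map_smul' := fun c x => Subtype.ext (L.map_smul c x) }
  exact ⟨S.mkContinuous C fun x =>
    norm_le_of_forall_sum_le (by positivity) _ (h1 x) (h2 x), fun x i => rfl⟩

theorem exists_multiplier {C : ℝ} (a : ℕ → ℝ) (ha : ∀ n, |a n| ≤ C) :
    ∃ S : RosenthalX p w →L[ℝ] RosenthalX p w, ∀ x i, S x i = a i * x i := by
  have hC : 0 ≤ C := (abs_nonneg _).trans (ha 0)
  have hp0 : 0 ≤ p := by linarith [hp.out]
  refine exists_clm_of_forall_sum_le hC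
    { toFun := fun x i => a i * x i
      map_add' := fun x y => funext fun i => mul_add _ _ _
      map_smul' := fun c x => funext fun i => mul_left_comm _ _ _ } ?_ ?_
  · intro x s
    rw [Real.mul_rpow hC (norm_nonneg _)]
    refine le_trans ?_ (mul_le_mul_of_nonneg_left (sum_abs_rpow_le x s) (by positivity))
    rw [Finset.mul_sum]
    refine Finset.sum_le_sum fun i _ => ?_
    change |a i * x i| ^ p ≤ _
    rw [abs_mul, Real.mul_rpow (abs_nonneg _) (abs_nonneg _)]
    gcongr
    exact ha i
  · intro x s
    rw [mul_pow]
    refine le_trans ?_ (mul_le_mul_of_nonneg_left (sum_sq_le x s) (by positivity))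
    rw [Finset.mul_sum]
    refine Finset.sum_le_sum fun i _ => ?_
    change (a i * x i * w i) ^ 2 ≤ _
    rw [mul_assoc, mul_pow]
    exact mul_le_mul_of_nonneg_right (sq_le_sq.2 ((ha i).trans (le_abs_self C))) (sq_nonneg _)

/-- Two disjointly supported elements of the unit ball have a sum of norm at most `√2`: here
`2 < p` enters through `2 ^ (1 / p) ≤ 2 ^ (1 / 2)`. -/
theorem norm_add_le_sqrt_two {x y : RosenthalX p w} (hx : ‖x‖ ≤ 1) (hy : ‖y‖ ≤ 1)
    (hxy : ∀ i, x i = 0 ∨ y i = 0) : ‖x + y‖ ≤ √2 := by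
  have hp0 : 0 < p := by linarith [hp.out]
  refine norm_le_of_forall_sum_le (Real.sqrt_nonneg _) _ (fun s => ?_) fun s => ?_
  · have h1 : ∑ i ∈ s, |(x + y) i| ^ p = ∑ i ∈ s, |x i| ^ p + ∑ i ∈ s, |y i| ^ p := by
      rw [← Finset.sum_add_distrib]
      refine Finset.sum_congr rfl fun i _ => ?_
      rcases hxy i with h | h <;> simp [h, Real.zero_rpow hp0.ne']
    have h2 : (2 : ℝ) ≤ √2 ^ p := by
      calc (2 : ℝ) = √2 ^ (2 : ℝ) := by simp
        _ ≤ √2 ^ p := Real.rpow_le_rpow_of_exponent_le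
            (Real.one_le_sqrt.2 (by norm_num)) hp.out.le
    have h3 := (sum_abs_rpow_le x s).trans (Real.rpow_le_one (norm_nonneg _) hx hp0.le)
    have h4 := (sum_abs_rpow_le y s).trans (Real.rpow_le_one (norm_nonneg _) hy hp0.le)
    linarith
  · have h1 : ∑ i ∈ s, ((x + y) i * w i) ^ 2 =
        ∑ i ∈ s, (x i * w i) ^ 2 + ∑ i ∈ s, (y i * w i) ^ 2 := by
      rw [← Finset.sum_add_distrib]
      refine Finset.sum_congr rfl fun i _ => ?_
      rcases hxy i with h | h <;> simp [h]
    have h3 := (sum_sq_le x s).trans (pow_le_one₀ (norm_nonneg _) hx)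
    have h4 := (sum_sq_le y s).trans (pow_le_one₀ (norm_nonneg _) hy)
    rw [Real.sq_sqrt (by norm_num)]
    linarith

/-- The unit vector basis is shrinking, on finitely supported vectors: a bounded functional is
small on the finitely supported vectors far out. Otherwise, adding two disjoint vectors of the unit
ball and dividing by `√2` would multiply the values of the functional by `√2`, again and again. -/
theorem exists_forall_support_le (φ : StrongDual ℝ (RosenthalX p w)) {ε : ℝ} (hε : 0 < ε) :
    ∃ N, ∀ (x : RosenthalX p w) (E : Finset ℕ), (∀ j ∈ E, N ≤ j) → (∀ j ∉ E, x j = 0) →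
      |φ x| ≤ ε * ‖x‖ := by
  by_contra! hcon
  have key : ∀ k N : ℕ, ∃ (x : RosenthalX p w) (E : Finset ℕ), (∀ j ∈ E, N ≤ j) ∧
      (∀ j ∉ E, x j = 0) ∧ ‖x‖ ≤ 1 ∧ ε * √2 ^ k < φ x := by
    intro k
    induction k with
    | zero =>
      intro N
      obtain ⟨x, E, hE, hx, h⟩ := hcon N
      have hx0 : 0 < ‖x‖ := by
        rw [norm_pos_iff]
        rintro rfl
        simp at h
      have hz : ∀ c : ℝ, ∀ j ∉ E, (c • x) j = 0 := fun c j hj => by simp [hx j hj]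
      rcases abs_cases (φ x) with ⟨ha, -⟩ | ⟨ha, -⟩
      · refine ⟨‖x‖⁻¹ • x, E, hE, hz _, ?_, ?_⟩
        · rw [norm_smul, norm_inv, norm_norm, inv_mul_cancel₀ hx0.ne']
        · rw [map_smul, smul_eq_mul, pow_zero, mul_one, inv_mul_eq_div, lt_div_iff₀ hx0]
          linarith
      · refine ⟨(-‖x‖⁻¹) • x, E, hE, hz _, ?_, ?_⟩
        · rw [norm_smul, norm_neg, norm_inv, norm_norm, inv_mul_cancel₀ hx0.ne']
        · rw [map_smul, smul_eq_mul, pow_zero, mul_one, neg_mul, ← mul_neg, inv_mul_eq_div,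
            lt_div_iff₀ hx0]
          linarith
    | succ k ih =>
      intro N
      obtain ⟨x, E, hE, hx, hx1, hφx⟩ := ih N
      obtain ⟨y, F, hF, hy, hy1, hφy⟩ := ih (max N (E.sup id + 1))
      have hdisj : ∀ j, x j = 0 ∨ y j = 0 := by
        intro j
        by_cases hj : j ∈ E
        · refine Or.inr (hy j fun hjF => ?_)
          have h1 := hF j hjF
          have h2 : j ≤ E.sup id := Finset.le_sup (f := id) hj
          have h3 := le_max_right N (E.sup id + 1)
          omega
        · exact Or.inl (hx j hj)
      have h2 : (0 : ℝ) < √2 := by positivity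
      refine ⟨(√2)⁻¹ • (x + y), E ∪ F, ?_, ?_, ?_, ?_⟩
      · intro j hj
        rcases Finset.mem_union.1 hj with h | h
        · exact hE j h
        · exact (le_max_left _ _).trans (hF j h)
      · intro j hj
        rw [Finset.mem_union, not_or] at hj
        simp [hx j hj.1, hy j hj.2]
      · rw [norm_smul, norm_inv, Real.norm_of_nonneg h2.le, inv_mul_eq_div, div_le_one h2]
        exact norm_add_le_sqrt_two hx1 hy1 hdisj
      · rw [map_smul, smul_eq_mul, inv_mul_eq_div, lt_div_iff₀ h2, map_add, pow_succ]
        have h3 : √2 * √2 = 2 := Real.mul_self_sqrt (by norm_num)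
        calc ε * (√2 ^ k * √2) * √2 = ε * √2 ^ k * (√2 * √2) := by ring
          _ = ε * √2 ^ k + ε * √2 ^ k := by rw [h3]; ring
          _ < _ := add_lt_add hφx hφy
  have h1 : (1 : ℝ) < √2 := Real.lt_sqrt_of_sq_lt (by norm_num)
  obtain ⟨k, hk⟩ := pow_unbounded_of_one_lt (‖φ‖ / ε) h1
  obtain ⟨x, -, -, -, hx1, hφ⟩ := key k 0
  have h2 : φ x ≤ ‖φ‖ := (le_abs_self _).trans (φ.unit_le_opNorm x hx1)
  rw [div_lt_iff₀ hε] at hk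
  linarith

/-- The `ℓ_p`-mass of an element is small far out. -/
theorem exists_forall_sum_rpow_le (x : RosenthalX p w) {ε : ℝ} (hε : 0 < ε) :
    ∃ N, ∀ E : Finset ℕ, (∀ j ∈ E, N ≤ j) → ∑ j ∈ E, |x j| ^ p ≤ ε := by
  have hs : Summable fun j => |x j| ^ p :=
    summable_of_sum_le (fun j => by positivity) (sum_abs_rpow_le x)
  obtain ⟨s, hs⟩ := summable_iff_vanishing.1 hs (Metric.ball 0 ε) (Metric.ball_mem_nhds 0 hε)
  refine ⟨s.sup id + 1, fun E hE => ?_⟩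
  have h := hs E (Finset.disjoint_left.2 fun j hj hjs => by
    have h1 := hE j hj
    have h2 : j ≤ s.sup id := Finset.le_sup (f := id) hjs
    omega)
  rw [mem_ball_zero_iff] at h
  exact (le_abs_self _).trans h.le

end NormEstimates

/-! ### Blocks of coordinates -/

section Blocks

/-- A block of weight comparable to `t`: on the finite set `E`, the coefficients `c` of a vector
and `d` of a functional, such that the vector has `ℓ_p`-norm at most `1` and weighted `ℓ_2`-norm at
most `2t`, and the functional, restricted to `E`, has norm at most `1` for the `ℓ_p`-norm and at
most `t⁻¹` for the weighted `ℓ_2`-norm. -/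
structure IsBlock (p : ℝ) (w : ℕ → ℝ) (t : ℝ) (E : Finset ℕ) (c d : ℕ → ℝ) : Prop where
  sum_rpow_le : ∑ j ∈ E, |c j| ^ p ≤ 1
  sum_sq_le : ∑ j ∈ E, (c j * w j) ^ 2 ≤ (2 * t) ^ 2
  abs_rpow_le : ∀ y : ℕ → ℝ, |∑ j ∈ E, d j * y j| ^ p ≤ ∑ j ∈ E, |y j| ^ p
  sq_le : ∀ y : ℕ → ℝ, ((∑ j ∈ E, d j * y j) * t) ^ 2 ≤ ∑ j ∈ E, (y j * w j) ^ 2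

theorem IsBlock.sign_mul {t : ℝ} {E : Finset ℕ} {c d θ : ℕ → ℝ} (h : IsBlock p w t E c d)
    (hθ : ∀ j, θ j = 1 ∨ θ j = -1) :
    IsBlock p w t E (fun j => θ j * c j) (fun j => θ j * d j) := by
  have ha : ∀ j, |θ j| = 1 := fun j => by rcases hθ j with h | h <;> simp [h]
  have hs : ∀ j, θ j ^ 2 = 1 := fun j => by rcases hθ j with h | h <;> simp [h]
  have hd : ∀ y : ℕ → ℝ, ∑ j ∈ E, θ j * d j * y j = ∑ j ∈ E, d j * (θ j * y j) := fun y =>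
    Finset.sum_congr rfl fun j _ => by ring
  refine ⟨?_, ?_, fun y => ?_, fun y => ?_⟩
  · simpa [abs_mul, ha] using h.sum_rpow_le
  · simpa [mul_assoc, mul_pow, hs] using h.sum_sq_le
  · rw [hd]
    simpa [abs_mul, ha] using h.abs_rpow_le fun j => θ j * y j
  · rw [hd]
    refine (h.sq_le fun j => θ j * y j).trans_eq ?_
    exact Finset.sum_congr rfl fun j _ => by rw [mul_assoc, mul_pow, hs, one_mul]

/-- A suitable choice of signs makes a quadratic form at least as large as its trace. -/
theorem exists_sign_sum_diag_le (M : ℕ → ℕ → ℝ) (E : Finset ℕ) :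
    ∃ θ : ℕ → ℝ, (∀ j, θ j = 1 ∨ θ j = -1) ∧
      ∑ i ∈ E, M i i ≤ ∑ i ∈ E, ∑ j ∈ E, θ i * θ j * M i j := by
  classical
  induction E using Finset.induction_on with
  | empty => exact ⟨fun _ => 1, fun _ => Or.inl rfl, by simp⟩
  | insert a E ha ih =>
    obtain ⟨θ, hθ, hsum⟩ := ih
    set r := ∑ j ∈ E, θ j * (M a j + M j a) with hr
    obtain ⟨σ, hσ, hσr⟩ : ∃ σ : ℝ, (σ = 1 ∨ σ = -1) ∧ 0 ≤ σ * r := by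
      rcases le_total 0 r with h | h
      · exact ⟨1, Or.inl rfl, by simpa using h⟩
      · exact ⟨-1, Or.inr rfl, by linarith⟩
    have hE : ∀ j ∈ E, Function.update θ a σ j = θ j := fun j hj =>
      Function.update_of_ne (ne_of_mem_of_not_mem hj ha) _ _
    refine ⟨Function.update θ a σ, fun j => ?_, ?_⟩
    · by_cases h : j = a
      · subst h; simpa using hσ
      · simpa [h] using hθ j
    · have h1 : ∑ i ∈ insert a E, ∑ j ∈ insert a E,
          Function.update θ a σ i * Function.update θ a σ j * M i j =
          M a a + σ * r + ∑ i ∈ E, ∑ j ∈ E, θ i * θ j * M i j := by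
        have hσ2 : σ * σ = 1 := by rcases hσ with h | h <;> simp [h]
        rw [Finset.sum_insert ha, Finset.sum_insert ha]
        have h2 : ∑ i ∈ E, ∑ j ∈ insert a E,
            Function.update θ a σ i * Function.update θ a σ j * M i j =
            ∑ i ∈ E, (θ i * σ * M i a + ∑ j ∈ E, θ i * θ j * M i j) := by
          refine Finset.sum_congr rfl fun i hi => ?_
          rw [Finset.sum_insert ha, hE i hi, Function.update_self]
          congr 1
          exact Finset.sum_congr rfl fun j hj => by rw [hE j hj]
        have h3 : ∑ j ∈ E, Function.update θ a σ a * Function.update θ a σ j * M a j =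
            ∑ j ∈ E, σ * θ j * M a j :=
          Finset.sum_congr rfl fun j hj => by rw [hE j hj, Function.update_self]
        have h4 : σ * r = ∑ j ∈ E, σ * θ j * M a j + ∑ i ∈ E, θ i * σ * M i a := by
          rw [hr, Finset.mul_sum, ← Finset.sum_add_distrib]
          exact Finset.sum_congr rfl fun j _ => by ring
        rw [h2, h3, Finset.sum_add_distrib, Function.update_self, hσ2, h4]
        ring
      rw [h1, Finset.sum_insert ha]
      linarith

/-- Finite sets far out over which a null sequence with divergent sum has a sum comparable to a
given number. -/
theorem exists_finset_sum_mem_Icc {a : ℕ → ℝ} (ha : Tendsto a atTop (𝓝 0))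
    (hsum : Tendsto (fun N => ∑ n ∈ Finset.range N, a n) atTop atTop) {t : ℝ} (ht : 0 < t)
    (N : ℕ) : ∃ E : Finset ℕ, (∀ j ∈ E, N ≤ j) ∧ t ≤ ∑ j ∈ E, a j ∧ ∑ j ∈ E, a j ≤ 2 * t := by
  classical
  obtain ⟨N₁, hN₁⟩ := eventually_atTop.1 (ha.eventually_lt_const ht)
  set K := max N N₁
  have hex : ∃ m, t ≤ ∑ j ∈ Finset.Ico K (K + m), a j := by
    obtain ⟨m, hm⟩ := eventually_atTop.1
      (hsum.eventually_ge_atTop (t + ∑ n ∈ Finset.range K, a n))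
    refine ⟨m, ?_⟩
    rw [Finset.sum_Ico_eq_sub _ (Nat.le_add_right _ _)]
    linarith [hm (K + m) (Nat.le_add_left _ _)]
  refine ⟨Finset.Ico K (K + Nat.find hex), fun j hj => ?_, Nat.find_spec hex, ?_⟩
  · exact (le_max_left _ _).trans (Finset.mem_Ico.1 hj).1
  · rcases hm : Nat.find hex with _ | m
    · simpa using ht.le
    · have h1 : ∑ j ∈ Finset.Ico K (K + m), a j < t :=
        not_le.1 (Nat.find_min hex (by omega))
      have h2 : a (K + m) < t := hN₁ _ ((le_max_right _ _).trans (Nat.le_add_right _ _))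
      rw [← add_assoc, Finset.sum_Ico_succ_top (Nat.le_add_right _ _)]
      linarith

/-- Rosenthal's blocks. With `q = 2p / (p - 2)`, choose `E` such that the sum `S` of `w_j ^ q` over
`E` is comparable to `t ^ q`, let `l_j = w_j ^ q / S`, a probability on `E`, and take the vector
`c_j = l_j ^ (1 / p)` and the functional `d_j = l_j / c_j`. Because `2 / p + 2 / q = 1`, one has
`(c_j w_j) ^ 2 = (S ^ (1 / q)) ^ 2 * l_j`, so that both bounds for the functional are instances of
Jensen's inequality for `l`. -/
theorem exists_isBlock (hp : 2 < p) (hw : IsRosenthalWeight p w) {t : ℝ} (ht : 0 < t) (N : ℕ) :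
    ∃ (E : Finset ℕ) (c d : ℕ → ℝ), (∀ j ∈ E, N ≤ j) ∧ IsBlock p w t E c d ∧
      (∀ j ∈ E, 0 ≤ d j * c j) ∧ ∑ j ∈ E, d j * c j = 1 := by
  have hp2 : 0 < p - 2 := by linarith
  have hp0 : 0 < p := by linarith
  set q := 2 * p / (p - 2) with hq
  have hq0 : 0 < q := by positivity
  have hpq : 2 / p + 2 / q = 1 := by rw [hq]; field_simp; ring
  have hq2 : 2 / q ≤ 1 := by have : 0 < 2 / p := by positivity
                             linarith
  have hlim : Tendsto (fun n => w n ^ q) atTop (𝓝 0) := by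
    simpa [Real.zero_rpow hq0.ne'] using hw.tendsto_zero.rpow_const (Or.inr hq0.le)
  obtain ⟨E, hE, hS1, hS2⟩ := exists_finset_sum_mem_Icc hlim hw.sum_eq_top
    (Real.rpow_pos_of_pos ht q) N
  set S := ∑ j ∈ E, w j ^ q with hS
  have hS0 : 0 < S := (Real.rpow_pos_of_pos ht q).trans_le hS1
  set l : ℕ → ℝ := fun j => w j ^ q / S with hl
  have hl0 : ∀ j, 0 < l j := fun j => div_pos (Real.rpow_pos_of_pos (hw.pos j) q) hS0
  have hl1 : ∑ j ∈ E, l j = 1 := by rw [hl, ← Finset.sum_div]; exact div_self hS0.ne'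
  set c : ℕ → ℝ := fun j => l j ^ (1 / p) with hc
  have hc0 : ∀ j, 0 < c j := fun j => Real.rpow_pos_of_pos (hl0 j) _
  have hcp : ∀ j, c j ^ p = l j := fun j => by
    rw [hc, ← Real.rpow_mul (hl0 j).le, one_div_mul_cancel hp0.ne', Real.rpow_one]
  have hcw : ∀ j, (c j * w j) ^ 2 = S ^ (2 / q) * l j := fun j => by
    have h1 : w j = (l j * S) ^ (1 / q) := by
      rw [hl]
      simp only
      rw [div_mul_cancel₀ _ hS0.ne', ← Real.rpow_mul (hw.pos j).le, mul_one_div_cancel hq0.ne',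
        Real.rpow_one]
    have h2 : w j ^ 2 = l j ^ (2 / q) * S ^ (2 / q) := by
      rw [h1, ← Real.rpow_natCast, ← Real.rpow_mul (mul_pos (hl0 j) hS0).le,
        ← Real.mul_rpow (hl0 j).le hS0.le]
      congr 1
      push_cast; ring
    have h3 : c j ^ 2 = l j ^ (2 / p) := by
      rw [hc, ← Real.rpow_natCast, ← Real.rpow_mul (hl0 j).le]
      congr 1
      push_cast; ring
    rw [mul_pow, h2, h3, ← mul_assoc, ← Real.rpow_add (hl0 j), hpq, Real.rpow_one, mul_comm]
  have hlow : t ^ 2 ≤ S ^ (2 / q) := by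
    calc t ^ 2 = (t ^ q) ^ (2 / q) := by
          rw [← Real.rpow_mul ht.le, mul_div_cancel₀ _ hq0.ne', Real.rpow_two]
      _ ≤ _ := Real.rpow_le_rpow (by positivity) hS1 (by positivity)
  have hupp : S ^ (2 / q) ≤ (2 * t) ^ 2 := by
    calc S ^ (2 / q) ≤ (2 * t ^ q) ^ (2 / q) := Real.rpow_le_rpow hS0.le hS2 (by positivity)
      _ = 2 ^ (2 / q) * t ^ 2 := by
          rw [Real.mul_rpow (by norm_num) (by positivity), ← Real.rpow_mul ht.le,
            mul_div_cancel₀ _ hq0.ne', Real.rpow_two]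
      _ ≤ 2 ^ (2 : ℝ) * t ^ 2 := by
          gcongr
          · norm_num
          · linarith
      _ = _ := by rw [Real.rpow_two]; ring
  have hd : ∀ y : ℕ → ℝ, ∑ j ∈ E, l j / c j * y j = ∑ j ∈ E, l j * (y j / c j) := fun y =>
    Finset.sum_congr rfl fun j _ => by ring
  refine ⟨E, c, fun j => l j / c j, hE, ⟨?_, ?_, fun y => ?_, fun y => ?_⟩, fun j _ => ?_, ?_⟩
  · refine le_of_eq ?_
    rw [← hl1]
    exact Finset.sum_congr rfl fun j _ => by rw [abs_of_pos (hc0 j), hcp]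
  · simp_rw [hcw]
    rwa [← Finset.mul_sum, hl1, mul_one]
  · rw [hd]
    calc |∑ j ∈ E, l j * (y j / c j)| ^ p ≤ (∑ j ∈ E, l j * |y j / c j|) ^ p := by
          refine Real.rpow_le_rpow (abs_nonneg _) ?_ hp0.le
          refine (Finset.abs_sum_le_sum_abs _ _).trans_eq (Finset.sum_congr rfl fun j _ => ?_)
          rw [abs_mul, abs_of_pos (hl0 j)]
      _ ≤ ∑ j ∈ E, l j * |y j / c j| ^ p :=
          Real.rpow_arith_mean_le_arith_mean_rpow _ _ _ (fun j _ => (hl0 j).le) hl1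
            (fun j _ => abs_nonneg _) (by linarith)
      _ = ∑ j ∈ E, |y j| ^ p := Finset.sum_congr rfl fun j _ => by
          rw [abs_div, abs_of_pos (hc0 j), Real.div_rpow (abs_nonneg _) (hc0 j).le, hcp,
            mul_div_cancel₀ _ (hl0 j).ne']
  · rw [hd]
    calc ((∑ j ∈ E, l j * (y j / c j)) * t) ^ 2
        = (∑ j ∈ E, l j * (y j / c j)) ^ 2 * t ^ 2 := mul_pow _ _ _
      _ ≤ (∑ j ∈ E, l j * (y j / c j) ^ 2) * S ^ (2 / q) := by
          gcongr
          · exact Finset.sum_nonneg fun j _ => mul_nonneg (hl0 j).le (sq_nonneg _)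
          · exact Real.pow_arith_mean_le_arith_mean_pow_of_even _ _ _ (fun j _ => (hl0 j).le) hl1
              even_two
      _ = ∑ j ∈ E, (y j * w j) ^ 2 := by
          rw [Finset.sum_mul]
          refine Finset.sum_congr rfl fun j _ => ?_
          have h := hcw j
          have h0 := (hc0 j).ne'
          calc l j * (y j / c j) ^ 2 * S ^ (2 / q)
              = (y j / c j) ^ 2 * (S ^ (2 / q) * l j) := by ring
            _ = (y j / c j) ^ 2 * (c j * w j) ^ 2 := by rw [h]
            _ = _ := by field_simp
  · exact mul_nonneg (div_pos (hl0 j) (hc0 j)).le (hc0 j).le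
  · rw [← hl1]
    exact Finset.sum_congr rfl fun j _ => div_mul_cancel₀ _ (hc0 j).ne'

theorem sum_le_sum_of_support {f : ℕ → ℝ} {E : Finset ℕ} (hf : ∀ i, 0 ≤ f i)
    (hE : ∀ i ∉ E, f i = 0) (s : Finset ℕ) : ∑ i ∈ s, f i ≤ ∑ i ∈ E, f i := by
  classical
  calc ∑ i ∈ s, f i ≤ ∑ i ∈ s ∪ E, f i :=
        Finset.sum_le_sum_of_subset_of_nonneg Finset.subset_union_left fun i _ _ => hf i
    _ = ∑ i ∈ E, f i :=
        (Finset.sum_subset Finset.subset_union_right fun i _ hi => hE i hi).symm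

/-- The vector `∑_{j ∈ E} c_j e_j`. -/
def blockVector (p : ℝ) (w : ℕ → ℝ) (E : Finset ℕ) (c : ℕ → ℝ) : RosenthalX p w :=
  ∑ j ∈ E, c j • unitVector p w j

/-- The functional `∑_{j ∈ E} d_j e_j^*`. -/
def blockFunctional (p : ℝ) [Fact (2 < p)] (w : ℕ → ℝ) (E : Finset ℕ) (d : ℕ → ℝ) :
    StrongDual ℝ (RosenthalX p w) :=
  ∑ j ∈ E, d j • coordFunctional p w j

theorem unitVector_apply (i j : ℕ) : unitVector p w i j = if j = i then 1 else 0 := by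
  change (Pi.single i 1 : ℕ → ℝ) j = _
  rw [Pi.single_apply]

variable [hp : Fact (2 < p)]

theorem coordFunctional_apply (i : ℕ) (x : RosenthalX p w) : coordFunctional p w i x = x i := rfl

theorem blockFunctional_apply (E : Finset ℕ) (d : ℕ → ℝ) (x : RosenthalX p w) :
    blockFunctional p w E d x = ∑ j ∈ E, d j * x j := by
  simp [blockFunctional, coordFunctional_apply]

theorem blockVector_apply (E : Finset ℕ) (c : ℕ → ℝ) (j : ℕ) :
    blockVector p w E c j = if j ∈ E then c j else 0 := by
  rw [← coordFunctional_apply, blockVector, map_sum]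
  simp [coordFunctional_apply, unitVector_apply]

theorem IsBlock.norm_blockVector_le {t : ℝ} {E : Finset ℕ} {c d : ℕ → ℝ} (ht : 0 < t)
    (h : IsBlock p w t E c d) : ‖blockVector p w E c‖ ≤ 1 + 2 * t := by
  have hp0 : 0 < p := by linarith [hp.out]
  refine norm_le_of_forall_sum_le (by positivity) _ (fun s => ?_) fun s => ?_
  · calc ∑ i ∈ s, |blockVector p w E c i| ^ p ≤ ∑ i ∈ E, |c i| ^ p := by
          simp_rw [blockVector_apply]
          refine (sum_le_sum_of_support (E := E) (fun i => by positivity) (fun i hi => ?_)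
            s).trans_eq (Finset.sum_congr rfl fun i hi => by rw [if_pos hi])
          simp [hi, Real.zero_rpow hp0.ne']
      _ ≤ 1 := h.sum_rpow_le
      _ ≤ _ := Real.one_le_rpow (by linarith) hp0.le
  · calc ∑ i ∈ s, (blockVector p w E c i * w i) ^ 2 ≤ ∑ i ∈ E, (c i * w i) ^ 2 := by
          simp_rw [blockVector_apply]
          refine (sum_le_sum_of_support (E := E) (fun i => by positivity) (fun i hi => ?_)
            s).trans_eq (Finset.sum_congr rfl fun i hi => by rw [if_pos hi])
          simp [hi]
      _ ≤ (2 * t) ^ 2 := h.sum_sq_le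
      _ ≤ _ := pow_le_pow_left₀ (by positivity) (by linarith) 2

/-- Far out there are blocks on which the compression of an operator with diagonal at least `δ` is
at least `δ`: the choice of signs removes the off-diagonal terms. -/
theorem exists_isBlock_le_apply (hw : IsRosenthalWeight p w)
    (T : RosenthalX p w →L[ℝ] RosenthalX p w) {δ : ℝ} (hT : ∀ n, δ ≤ T (unitVector p w n) n)
    {t : ℝ} (ht : 0 < t) (N : ℕ) :
    ∃ (E : Finset ℕ) (c d : ℕ → ℝ), (∀ j ∈ E, N ≤ j) ∧ IsBlock p w t E c d ∧
      δ ≤ blockFunctional p w E d (T (blockVector p w E c)) := by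
  obtain ⟨E, c, d, hE, hb, hdc, hsum⟩ := exists_isBlock hp.out hw ht N
  obtain ⟨θ, hθ, hM⟩ :=
    exists_sign_sum_diag_le (fun i j => d i * c j * T (unitVector p w j) i) E
  refine ⟨E, _, _, hE, hb.sign_mul hθ, ?_⟩
  calc δ = ∑ i ∈ E, d i * c i * δ := by rw [← Finset.sum_mul, hsum, one_mul]
    _ ≤ ∑ i ∈ E, d i * c i * T (unitVector p w i) i :=
        Finset.sum_le_sum fun i hi => mul_le_mul_of_nonneg_left (hT i) (hdc i hi)
    _ ≤ _ := hM
    _ = _ := by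
        rw [blockFunctional_apply]
        refine Finset.sum_congr rfl fun i _ => ?_
        rw [blockVector, map_sum, ← coordFunctional_apply i (∑ _ ∈ E, _), map_sum, Finset.mul_sum]
        refine Finset.sum_congr rfl fun j _ => ?_
        rw [map_smul, map_smul, coordFunctional_apply, smul_eq_mul]
        ring

end Blocks

/-! ### Sequences of disjoint blocks -/

section BlockSequences

/-- If `ν j` names one index for each `j` and each `F n` lives on `E n`, then a sum of `F (ν j) j`
splits along the fibres of `ν`. -/
theorem sum_owner_le {ν : ℕ → ℕ} {F : ℕ → ℕ → ℝ} {E : ℕ → Finset ℕ} {B : ℕ → ℝ}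
    (hF : ∀ n j, 0 ≤ F n j) (hsupp : ∀ n, ∀ j ∉ E n, F n j = 0)
    (hB : ∀ n, ∑ j ∈ E n, F n j ≤ B n) (s : Finset ℕ) :
    ∑ j ∈ s, F (ν j) j ≤ ∑ n ∈ s.image ν, B n := by
  rw [← Finset.sum_fiberwise_of_maps_to (g := ν) (t := s.image ν)
    fun j hj => Finset.mem_image_of_mem ν hj]
  refine Finset.sum_le_sum fun n _ => ?_
  calc ∑ j ∈ s with ν j = n, F (ν j) j = ∑ j ∈ s with ν j = n, F n j :=
        Finset.sum_congr rfl fun j hj => by rw [(Finset.mem_filter.1 hj).2]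
    _ ≤ ∑ j ∈ E n, F n j := sum_le_sum_of_support (hF n) (hsupp n) _
    _ ≤ B n := hB n

/-- A sequence constructed step by step, with conditions that relate each term to all earlier
ones. -/
theorem exists_seq_of_forall_lt_exists {α : Type*} [Nonempty α] {P : ℕ → α → Prop}
    {r : ℕ → α → α → Prop}
    (h : ∀ (n : ℕ) (a : ℕ → α), ∃ y, P n y ∧ ∀ m < n, r n (a m) y) :
    ∃ a : ℕ → α, ∀ n, P n (a n) ∧ ∀ m < n, r n (a m) (a n) := by
  classical
  choose next hnext using h
  let a : ℕ → α := fun n => Nat.strongRec (motive := fun _ => α)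
    (fun n prev => next n fun m => if hm : m < n then prev m hm else Classical.arbitrary α) n
  have ha : ∀ n, a n = next n fun m => if m < n then a m else Classical.arbitrary α := fun n => by
    conv_lhs => rw [show a n = Nat.strongRec _ n from rfl, Nat.strongRec_eq]
    rfl
  refine ⟨a, fun n => ?_⟩
  have h := hnext n fun m => if m < n then a m else Classical.arbitrary α
  rw [← ha n] at h
  exact ⟨h.1, fun m hm => by simpa [hm] using h.2 m hm⟩

variable [hp : Fact (2 < p)] {E : ℕ → Finset ℕ} {c d : ℕ → ℕ → ℝ}

/-- The block vectors of disjoint blocks are dominated by the unit vector basis. -/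
theorem exists_synthesis (hb : ∀ n, IsBlock p w (w n) (E n) (c n) (d n))
    (hE : ∀ m n, m ≠ n → Disjoint (E m) (E n)) :
    ∃ J : RosenthalX p w →L[ℝ] RosenthalX p w,
      ∀ n, J (unitVector p w n) = blockVector p w (E n) (c n) := by
  classical
  have hp0 : 0 < p := by linarith [hp.out]
  -- `ν j` is the index of the block that contains `j`, if there is one
  obtain ⟨ν, hν⟩ : ∃ ν : ℕ → ℕ, ∀ n, ∀ j ∈ E n, ν j = n := by
    refine ⟨fun j => if h : ∃ n, j ∈ E n then h.choose else 0, fun n j hj => ?_⟩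
    have h : ∃ n, j ∈ E n := ⟨n, hj⟩
    simp only [dif_pos h]
    by_contra hne
    exact Finset.disjoint_left.1 (hE _ _ hne) h.choose_spec hj
  set f : ℕ → RosenthalX p w := fun n => blockVector p w (E n) (c n) with hf
  have hf0 : ∀ n, ∀ j ∉ E n, f n j = 0 := fun n j hj => by
    rw [hf, blockVector_apply, if_neg hj]
  have hfc : ∀ n, ∀ j ∈ E n, f n j = c n j := fun n j hj => by
    rw [hf, blockVector_apply, if_pos hj]
  let L : RosenthalX p w →ₗ[ℝ] (ℕ → ℝ) :=
    { toFun := fun x j => x (ν j) * f (ν j) j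
      map_add' := fun x y => funext fun j => add_mul _ _ _
      map_smul' := fun a x => funext fun j => mul_assoc _ _ _ }
  obtain ⟨J, hJ⟩ : ∃ J : RosenthalX p w →L[ℝ] RosenthalX p w, ∀ x i, J x i = L x i := by
    refine exists_clm_of_forall_sum_le (C := 2) (by norm_num) L (fun x s => ?_) fun x s => ?_
    · calc ∑ j ∈ s, |x (ν j) * f (ν j) j| ^ p ≤ ∑ n ∈ s.image ν, |x n| ^ p := by
            refine sum_owner_le (F := fun n j => |x n * f n j| ^ p) (E := E)
              (fun n j => by positivity) (fun n j hj => ?_) (fun n => ?_) s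
            · simp [hf0 n j hj, Real.zero_rpow hp0.ne']
            · calc ∑ j ∈ E n, |x n * f n j| ^ p = |x n| ^ p * ∑ j ∈ E n, |c n j| ^ p := by
                    rw [Finset.mul_sum]
                    refine Finset.sum_congr rfl fun j hj => ?_
                    rw [hfc n j hj, abs_mul, Real.mul_rpow (abs_nonneg _) (abs_nonneg _)]
                _ ≤ |x n| ^ p * 1 :=
                    mul_le_mul_of_nonneg_left (hb n).sum_rpow_le (by positivity)
                _ = _ := mul_one _
        _ ≤ ‖x‖ ^ p := sum_abs_rpow_le x _
        _ ≤ _ := Real.rpow_le_rpow (norm_nonneg _) (by linarith [norm_nonneg x]) hp0.le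
    · calc ∑ j ∈ s, (x (ν j) * f (ν j) j * w j) ^ 2
          ≤ ∑ n ∈ s.image ν, 2 ^ 2 * (x n * w n) ^ 2 := by
            refine sum_owner_le (F := fun n j => (x n * f n j * w j) ^ 2) (E := E)
              (fun n j => by positivity) (fun n j hj => ?_) (fun n => ?_) s
            · simp [hf0 n j hj]
            · calc ∑ j ∈ E n, (x n * f n j * w j) ^ 2
                  = x n ^ 2 * ∑ j ∈ E n, (c n j * w j) ^ 2 := by
                    rw [Finset.mul_sum]
                    refine Finset.sum_congr rfl fun j hj => ?_
                    rw [hfc n j hj, mul_assoc, mul_pow]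
                _ ≤ x n ^ 2 * (2 * w n) ^ 2 :=
                    mul_le_mul_of_nonneg_left (hb n).sum_sq_le (by positivity)
                _ = _ := by ring
        _ ≤ (2 * ‖x‖) ^ 2 := by
            rw [← Finset.mul_sum, mul_pow]
            exact mul_le_mul_of_nonneg_left (sum_sq_le x _) (by norm_num)
  refine ⟨J, fun n => RosenthalX.ext fun j => ?_⟩
  rw [hJ]
  change unitVector p w n (ν j) * f (ν j) j = f n j
  rw [unitVector_apply]
  by_cases hj : j ∈ E n
  · rw [hν n j hj, if_pos rfl, one_mul]
  · by_cases h : ν j = n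
    · rw [if_pos h, one_mul, h]
    · rw [if_neg h, zero_mul, hf0 n j hj]

/-- The block functionals of disjoint blocks are the coordinates of a bounded operator. -/
theorem exists_analysis (hb : ∀ n, IsBlock p w (w n) (E n) (c n) (d n))
    (hE : ∀ m n, m ≠ n → Disjoint (E m) (E n)) :
    ∃ Q : RosenthalX p w →L[ℝ] RosenthalX p w,
      ∀ y n, Q y n = blockFunctional p w (E n) (d n) y := by
  classical
  have hE' : ∀ s : Finset ℕ, (s : Set ℕ).PairwiseDisjoint E := fun s m _ n _ h => hE m n h
  refine exists_clm_of_forall_sum_le (C := 1) (by norm_num)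
    (LinearMap.pi fun n => (blockFunctional p w (E n) (d n)).toLinearMap)
    (fun y s => ?_) (fun y s => ?_)
  · calc ∑ n ∈ s, |blockFunctional p w (E n) (d n) y| ^ p
        ≤ ∑ n ∈ s, ∑ j ∈ E n, |y j| ^ p := by
          refine Finset.sum_le_sum fun n _ => ?_
          rw [blockFunctional_apply]
          exact (hb n).abs_rpow_le y
      _ = ∑ j ∈ s.biUnion E, |y j| ^ p := (Finset.sum_biUnion (hE' s)).symm
      _ ≤ _ := by rw [one_mul]; exact sum_abs_rpow_le y _
  · calc ∑ n ∈ s, (blockFunctional p w (E n) (d n) y * w n) ^ 2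
        ≤ ∑ n ∈ s, ∑ j ∈ E n, (y j * w j) ^ 2 := by
          refine Finset.sum_le_sum fun n _ => ?_
          rw [blockFunctional_apply]
          exact (hb n).sq_le y
      _ = ∑ j ∈ s.biUnion E, (y j * w j) ^ 2 := (Finset.sum_biUnion (hE' s)).symm
      _ ≤ _ := by rw [one_mul]; exact sum_sq_le y _

/-- Disjoint blocks for which the compression of `T` is a small perturbation of its diagonal. -/
theorem exists_block_sequence (hw : IsRosenthalWeight p w)
    (T : RosenthalX p w →L[ℝ] RosenthalX p w) {δ : ℝ} (hT : ∀ n, δ ≤ T (unitVector p w n) n)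
    {η : ℕ → ℝ} (hη : ∀ n, 0 < η n) :
    ∃ (E : ℕ → Finset ℕ) (c d : ℕ → ℕ → ℝ),
      (∀ n, IsBlock p w (w n) (E n) (c n) (d n)) ∧ (∀ m n, m ≠ n → Disjoint (E m) (E n)) ∧
      (∀ n, δ ≤ blockFunctional p w (E n) (d n) (T (blockVector p w (E n) (c n)))) ∧
      ∀ n, ∀ m < n, |blockFunctional p w (E m) (d m) (T (blockVector p w (E n) (c n)))| ≤ η n ∧
        |blockFunctional p w (E n) (d n) (T (blockVector p w (E m) (c m)))| ≤ η n := by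
  have hp0 : 0 < p := by linarith [hp.out]
  have key := exists_seq_of_forall_lt_exists (α := Finset ℕ × (ℕ → ℝ) × (ℕ → ℝ))
    (P := fun n b => IsBlock p w (w n) b.1 b.2.1 b.2.2 ∧
      δ ≤ blockFunctional p w b.1 b.2.2 (T (blockVector p w b.1 b.2.1)))
    (r := fun n b b' => Disjoint b.1 b'.1 ∧
      |blockFunctional p w b.1 b.2.2 (T (blockVector p w b'.1 b'.2.1))| ≤ η n ∧
      |blockFunctional p w b'.1 b'.2.2 (T (blockVector p w b.1 b.2.1))| ≤ η n)
  obtain ⟨a, ha⟩ := key fun n a => by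
    have ht := hw.pos n
    choose N₁ hN₁ using fun m => exists_forall_support_le
      ((blockFunctional p w (a m).1 (a m).2.2).comp T)
      (div_pos (hη n) (by positivity : 0 < 1 + 2 * w n))
    choose N₂ hN₂ using fun m => exists_forall_sum_rpow_le
      (T (blockVector p w (a m).1 (a m).2.1)) (Real.rpow_pos_of_pos (hη n) p)
    obtain ⟨E, c, d, hE, hb, hd⟩ := exists_isBlock_le_apply hw T hT ht
      ((Finset.range n).sup fun m => max ((a m).1.sup id + 1) (max (N₁ m) (N₂ m)))
    refine ⟨(E, c, d), ⟨hb, hd⟩, fun m hm => ?_⟩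
    have hEm : ∀ j ∈ E, max ((a m).1.sup id + 1) (max (N₁ m) (N₂ m)) ≤ j := fun j hj =>
      (Finset.le_sup (f := fun m => max ((a m).1.sup id + 1) (max (N₁ m) (N₂ m)))
        (Finset.mem_range.2 hm)).trans (hE j hj)
    refine ⟨Finset.disjoint_left.2 fun j hj hjE => ?_, ?_, ?_⟩
    · have h1 := (le_max_left _ _).trans (hEm j hjE)
      have h2 : j ≤ (a m).1.sup id := Finset.le_sup (f := id) hj
      omega
    · have h := hN₁ m (blockVector p w E c) E
        (fun j hj => ((le_max_left _ _).trans (le_max_right _ _)).trans (hEm j hj))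
        (fun j hj => by rw [blockVector_apply, if_neg hj])
      refine h.trans ?_
      rw [div_mul_eq_mul_div, div_le_iff₀ (by positivity)]
      exact mul_le_mul_of_nonneg_left (hb.norm_blockVector_le ht) (hη n).le
    · have h := hN₂ m E
        (fun j hj => ((le_max_right _ _).trans (le_max_right _ _)).trans (hEm j hj))
      rw [← Real.rpow_le_rpow_iff (abs_nonneg _) (hη n).le hp0, blockFunctional_apply]
      exact (hb.abs_rpow_le _).trans h
  refine ⟨fun n => (a n).1, fun n => (a n).2.1, fun n => (a n).2.2, fun n => (ha n).1.1, ?_,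
    fun n => (ha n).1.2, fun n m hm => ((ha n).2 m hm).2⟩
  intro m n hmn
  rcases lt_or_gt_of_ne hmn with h | h
  · exact ((ha n).2 m h).1
  · exact ((ha m).2 n h).1.symm

end BlockSequences

/-! ### Small perturbations of diagonal operators -/

section Perturbation

variable [hp : Fact (2 < p)]

theorem norm_unitVector_le (hw : ∀ n, 0 < w n) (i : ℕ) : ‖unitVector p w i‖ ≤ 1 + w i := by
  have hp0 : 0 < p := by linarith [hp.out]
  have hi := hw i
  refine norm_le_of_forall_sum_le (by positivity) _ (fun s => ?_) fun s => ?_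
  · calc ∑ j ∈ s, |unitVector p w i j| ^ p ≤ ∑ j ∈ {i}, |unitVector p w i j| ^ p :=
          sum_le_sum_of_support (fun j => by positivity) (fun j hj => by
            rw [unitVector_apply, if_neg (by simpa using hj), abs_zero,
              Real.zero_rpow hp0.ne']) s
      _ = 1 := by simp [unitVector_apply]
      _ ≤ _ := Real.one_le_rpow (by linarith) hp0.le
  · calc ∑ j ∈ s, (unitVector p w i j * w j) ^ 2
        ≤ ∑ j ∈ {i}, (unitVector p w i j * w j) ^ 2 :=
          sum_le_sum_of_support (fun j => by positivity) (fun j hj => by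
            rw [unitVector_apply, if_neg (by simpa using hj)]; simp) s
      _ = w i ^ 2 := by simp [unitVector_apply]
      _ ≤ _ := pow_le_pow_left₀ hi.le (by linarith) 2

theorem tendsto_sum_unitVector (x : RosenthalX p w) :
    Tendsto (fun n => ∑ i ∈ Finset.range n, x i • unitVector p w i) atTop (𝓝 x) := by
  refine (SchauderBasis.tendsto_proj (unitVectorBasis p w) x).congr fun n => ?_
  rw [SchauderBasis.proj_apply]
  rfl

/-- An operator with a matrix of small entries, summable in both indices, has small norm. -/
theorem norm_le_of_matrix_le (hw : ∀ n, 0 < w n) {W : ℝ} (hW : ∀ n, w n ≤ W)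
    (K : RosenthalX p w →L[ℝ] RosenthalX p w) {κ : ℝ} (hκ : 0 ≤ κ)
    (hK : ∀ m n, |K (unitVector p w m) n| ≤ κ * (1 / 2) ^ m * (1 / 2) ^ n) :
    ‖K‖ ≤ 4 * κ * (1 + W) := by
  have hW0 : 0 < 1 + W := by linarith [hw 0, hW 0]
  refine K.opNorm_le_bound (by positivity) fun x => ?_
  have hcoord : ∀ n, |K x n| ≤ 2 * κ * ‖x‖ * (1 / 2) ^ n := by
    intro n
    have hlim := (((coordFunctional p w n).comp K).continuous.tendsto x).comp
      (tendsto_sum_unitVector x)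
    refine le_of_tendsto hlim.abs (Eventually.of_forall fun k => ?_)
    simp only [Function.comp_apply, map_sum, map_smul, smul_eq_mul,
      ContinuousLinearMap.comp_apply, coordFunctional_apply]
    calc |∑ m ∈ Finset.range k, x m * K (unitVector p w m) n|
        ≤ ∑ m ∈ Finset.range k, |x m * K (unitVector p w m) n| :=
          Finset.abs_sum_le_sum_abs _ _
      _ ≤ ∑ m ∈ Finset.range k, ‖x‖ * (κ * (1 / 2) ^ m * (1 / 2) ^ n) := by
          refine Finset.sum_le_sum fun m _ => ?_
          rw [abs_mul]
          exact mul_le_mul (abs_apply_le x m) (hK m n) (abs_nonneg _) (norm_nonneg _)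
      _ = κ * ‖x‖ * (1 / 2) ^ n * ∑ m ∈ Finset.range k, (1 / 2 : ℝ) ^ m := by
          rw [Finset.mul_sum]
          exact Finset.sum_congr rfl fun m _ => by ring
      _ ≤ κ * ‖x‖ * (1 / 2) ^ n * 2 :=
          mul_le_mul_of_nonneg_left (sum_geometric_two_le k) (by positivity)
      _ = _ := by ring
  refine le_of_tendsto (tendsto_sum_unitVector (K x)).norm (Eventually.of_forall fun k => ?_)
  calc ‖∑ n ∈ Finset.range k, K x n • unitVector p w n‖
      ≤ ∑ n ∈ Finset.range k, ‖K x n • unitVector p w n‖ := norm_sum_le _ _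
    _ ≤ ∑ n ∈ Finset.range k, 2 * κ * ‖x‖ * (1 / 2) ^ n * (1 + W) := by
        refine Finset.sum_le_sum fun n _ => ?_
        rw [norm_smul]
        exact mul_le_mul (hcoord n) ((norm_unitVector_le hw n).trans (by linarith [hW n]))
          (norm_nonneg _) (by positivity)
    _ = 2 * κ * ‖x‖ * (1 + W) * ∑ n ∈ Finset.range k, (1 / 2 : ℝ) ^ n := by
        rw [Finset.mul_sum]
        exact Finset.sum_congr rfl fun n _ => by ring
    _ ≤ 2 * κ * ‖x‖ * (1 + W) * 2 :=
        mul_le_mul_of_nonneg_left (sum_geometric_two_le k) (by positivity)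
    _ = _ := by ring

/-- An operator with diagonal at least `δ` and small off-diagonal entries has a left inverse: the
inverse `D` of its diagonal is bounded, and `D R` differs from the identity by an operator of norm
at most `1 / 2`. -/
theorem exists_leftInverse_of_offDiag_le (hw : ∀ n, 0 < w n) {W : ℝ} (hW : ∀ n, w n ≤ W)
    (R : RosenthalX p w →L[ℝ] RosenthalX p w) {δ : ℝ} (hδ : 0 < δ)
    (hdiag : ∀ n, δ ≤ R (unitVector p w n) n)
    (hoff : ∀ m n, m ≠ n →
      |R (unitVector p w m) n| ≤ δ / (8 * (1 + W)) * (1 / 2) ^ m * (1 / 2) ^ n) :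
    ∃ A : RosenthalX p w →L[ℝ] RosenthalX p w, A ∘L R = ContinuousLinearMap.id ℝ _ := by
  have hW0 : 0 < 1 + W := by linarith [hw 0, hW 0]
  have hd0 : ∀ n, 0 < R (unitVector p w n) n := fun n => hδ.trans_le (hdiag n)
  have hinv : ∀ n, |(R (unitVector p w n) n)⁻¹| ≤ δ⁻¹ := fun n => by
    rw [abs_inv, abs_of_pos (hd0 n)]
    exact inv_anti₀ hδ (hdiag n)
  obtain ⟨D, hD⟩ := exists_multiplier (p := p) (w := w) _ hinv
  set K : RosenthalX p w →L[ℝ] RosenthalX p w := ContinuousLinearMap.id ℝ _ - D ∘L R with hKdef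
  have hKapp : ∀ m n, K (unitVector p w m) n =
      unitVector p w m n - (R (unitVector p w n) n)⁻¹ * R (unitVector p w m) n := fun m n => by
    rw [← hD, ← coordFunctional_apply, hKdef]
    rfl
  have hK : ‖K‖ ≤ 4 * (1 / (8 * (1 + W))) * (1 + W) := by
    refine norm_le_of_matrix_le hw hW K (by positivity) fun m n => ?_
    rw [hKapp, unitVector_apply]
    by_cases hmn : n = m
    · subst hmn
      rw [if_pos rfl, inv_mul_cancel₀ (hd0 n).ne', sub_self, abs_zero]
      positivity
    · rw [if_neg hmn, zero_sub, abs_neg, abs_mul]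
      calc _ ≤ δ⁻¹ * (δ / (8 * (1 + W)) * (1 / 2) ^ m * (1 / 2) ^ n) :=
            mul_le_mul (hinv n) (hoff m n (Ne.symm hmn)) (abs_nonneg _) (by positivity)
        _ = _ := by field_simp
  have hK1 : ‖K‖ < 1 := hK.trans_lt (by
    have : 4 * (1 / (8 * (1 + W))) * (1 + W) = 1 / 2 := by field_simp; norm_num
    rw [this]; norm_num)
  obtain ⟨u, hu⟩ := isUnit_one_sub_of_norm_lt_one hK1
  have hu' : (u : RosenthalX p w →L[ℝ] RosenthalX p w) = D ∘L R := by
    rw [hu, hKdef]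
    exact sub_sub_cancel _ _
  refine ⟨(↑u⁻¹ : RosenthalX p w →L[ℝ] RosenthalX p w) ∘L D, ?_⟩
  rw [ContinuousLinearMap.comp_assoc, ← hu']
  exact u.inv_mul

end Perturbation

/-! ### Factorization -/

/-- With `J` the embedding along the blocks and `Q` the corresponding coordinates, `Q T J` has a
left inverse. -/
theorem isFactorOfIdentity_of_le_diag [hp : Fact (2 < p)] (hw : IsRosenthalWeight p w)
    (T : RosenthalX p w →L[ℝ] RosenthalX p w) {δ : ℝ} (hδ : 0 < δ)
    (hT : ∀ n, δ ≤ T (unitVector p w n) n) : IsFactorOfIdentity T := by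
  obtain ⟨W, hW⟩ := hw.tendsto_zero.bddAbove_range
  have hW : ∀ n, w n ≤ W := fun n => hW ⟨n, rfl⟩
  have hW0 : 0 < 1 + W := by linarith [hw.pos 0, hW 0]
  obtain ⟨E, c, d, hb, hE, hdiag, hoff⟩ := exists_block_sequence hw T hT
    (η := fun n => δ / (8 * (1 + W)) * (1 / 4) ^ n) (fun n => by positivity)
  obtain ⟨J, hJ⟩ := exists_synthesis hb hE
  obtain ⟨Q, hQ⟩ := exists_analysis hb hE
  have hR : ∀ m n, (Q ∘L T ∘L J) (unitVector p w m) n =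
      blockFunctional p w (E n) (d n) (T (blockVector p w (E m) (c m))) := fun m n => by
    rw [← hJ, ← hQ]; rfl
  -- `4⁻ᵏ ≤ 2⁻ᵐ 2⁻ⁿ` for `m, n ≤ k`
  have hpow : ∀ k m n : ℕ, m ≤ k → n ≤ k → δ / (8 * (1 + W)) * (1 / 4) ^ k ≤
      δ / (8 * (1 + W)) * (1 / 2) ^ m * (1 / 2) ^ n := fun k m n hm hn => by
    rw [mul_assoc, show (1 / 4 : ℝ) = 1 / 2 * (1 / 2) by norm_num, mul_pow]
    gcongr _ * (?_ * ?_)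
    · exact pow_le_pow_of_le_one (by norm_num) (by norm_num) hm
    · exact pow_le_pow_of_le_one (by norm_num) (by norm_num) hn
  obtain ⟨A, hA⟩ := exists_leftInverse_of_offDiag_le hw.pos hW (Q ∘L T ∘L J) hδ
    (fun n => by rw [hR]; exact hdiag n) (fun m n hmn => by
      rw [hR]
      rcases lt_or_gt_of_ne hmn with h | h
      · exact (hoff n m h).2.trans (hpow n m n h.le le_rfl)
      · exact (hoff m n h).1.trans (hpow m m n le_rfl h.le))
  exact ⟨A ∘L Q, J, hA.symm⟩

end RosenthalX

end

theorem mainTheorem3 (p : ℝ) [Fact (2 < p)] (w : ℕ → ℝ) (hw : IsRosenthalWeight p w) :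
    HasFactorizationProperty (RosenthalX.unitVectorBasis p w) := by
  intro T hT
  set t : ℕ → ℝ := fun n => T (RosenthalX.unitVector p w n) n with ht
  have hδ : ∀ n, ⨅ k, |t k| ≤ |t n| := fun n => ciInf_le ⟨0, by rintro _ ⟨k, rfl⟩; positivity⟩ n
  -- a multiplier by signs makes the diagonal positive
  obtain ⟨S, hS⟩ := RosenthalX.exists_multiplier (p := p) (w := w) (C := 1)
    (fun n => (SignType.sign (t n) : ℝ)) (fun n => by
      rcases lt_trichotomy (t n) 0 with h | h | h <;> simp [h])
  obtain ⟨A, B, hAB⟩ := RosenthalX.isFactorOfIdentity_of_le_diag hw (S ∘L T) hT fun n => by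
    rw [ContinuousLinearMap.comp_apply, hS, sign_mul_self]
    exact hδ n
  exact ⟨A ∘L S, B, hAB⟩
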